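/- Let $q$ be a prime power and let $n,k,d,s$ be non-negative integers with $k\ge 3$, $0<s<q-2$, $(s+2)\mid q$, $n=(s+1)(q+1)+k-3$ and $n-k+1-d=s$. A projective $[n,k,d]_q$ system is a multiset $\mathcal G$ of $n$ points of $\mathrm{PG}(k-1,q)$ such that $n-d$ is the maximum number of points of $\mathcal G$, counted with multiplicity, on a hyperplane; a linear $[n,k,d]_q$ code is a $k$-dimensional subspace of $\mathbb F_q^n$ with minimum Hamming distance $d$. Either object is called A$^s$MDS if its Singleton defect $n-k+1-d$ equals $s$, and a length-maximal A$^s$MDS code if moreover its length $n$ equals $(s+1)(q+1)+k-2$. (1) Every projective $[n,k,d]_q$ system $\mathcal G$ in $\mathrm{PG}(k-1,q)$ (which is A$^s$MDS by the assumption on the parameters) is contained in exactly one multiset $\mathcal G'$ of points of $\mathrm{PG}(k-1,q)$ that is a length-maximal A$^s$MDS code. (2) Equivalently, in terms of subspaces: for every linear $[n,k,d]_q$ code $C\subseteq\mathbb F_q^{n}$ there is a $k$-dimensional length-maximal A$^s$MDS code $C'\subseteq\mathbb F_q^{n+1}$ from which $C$ is obtained by deleting the last coordinate, and any two such codes $C'$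 differ only by multiplying the last coordinate by a nonzero scalar. -/

import Mathlib

open scoped LinearAlgebra.Projectivization

/-- The points of `PG(k - 1, F)`: the one-dimensional subspaces of `F ^ k`. -/
abbrev PG (k : ℕ) (F : Type*) [Field F] : Type _ := ℙ F (Fin k → F)

/-- Hyperplanes of `PG(k - 1, F)`, given by the linear subspaces of `F ^ k` of codimension one. -/
def IsHyperplane {k : ℕ} {F : Type*} [Field F] (H : Submodule F (Fin k → F)) : Prop :=
  Module.finrank F H + 1 = k

open Classical in
/-- The number of points of the multiset `G` that lie on `H`, counted with multiplicity. -/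
noncomputable def pointsOn {k : ℕ} {F : Type*} [Field F] (G : Multiset (PG k F))
    (H : Submodule F (Fin k → F)) : ℕ :=
  G.countP (fun P => P.submodule ≤ H)

/-- `G` is a projective `[n, k, d]` system over `F`: a multiset of `n` points of `PG(k - 1, F)`
such that `n - d` is the maximum number of points of `G` on a hyperplane. -/
def IsProjectiveSystem {k : ℕ} {F : Type*} [Field F] (n d : ℕ) (G : Multiset (PG k F)) : Prop :=
  Multiset.card G = n ∧
    ∃ r : ℕ, r + d = n ∧
      IsGreatest {m : ℕ | ∃ H : Submodule F (Fin k → F), IsHyperplane H ∧ pointsOn G H = m} r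

/-- The subspace `C` of `F ^ n` is a linear `[n, k, d]` code: it has dimension `k`, and `d` is the
least Hamming distance between two distinct codewords. -/
def IsLinearCode {n : ℕ} {F : Type*} [Field F] [DecidableEq F] (k d : ℕ)
    (C : Submodule F (Fin n → F)) : Prop :=
  Module.finrank F C = k ∧
    IsLeast {w : ℕ | ∃ x ∈ C, ∃ y ∈ C, x ≠ y ∧ hammingDist x y = w} d

/-- The Singleton defect `n - k + 1 - d` of the parameters `[n, k, d]`. -/
def singletonDefect (n k d : ℕ) : ℤ := (n : ℤ) - k + 1 - d

/-- `n` equals the upper bound `(s + 1)(q + 1) + k - 2` on the length of an `A^s MDS` code of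
dimension `k ≥ 3` over a field of order `q`. -/
def IsMaximalLength (q s k n : ℕ) : Prop :=
  (n : ℤ) = ((s : ℤ) + 1) * ((q : ℤ) + 1) + k - 2

/-- The projective system `G` is a length-maximal `A^s MDS` code of dimension `k` over `F`. -/
def IsLengthMaximalSystem {k : ℕ} {F : Type*} [Field F] [Fintype F] (s : ℕ)
    (G : Multiset (PG k F)) : Prop :=
  ∃ n d : ℕ, IsProjectiveSystem n d G ∧ singletonDefect n k d = s ∧
    IsMaximalLength (Fintype.card F) s k n

/-- The subspace `C` of `F ^ n` is a length-maximal `A^s MDS` code of dimension `k` over `F`. -/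
def IsLengthMaximalCode {n : ℕ} {F : Type*} [Field F] [Fintype F] [DecidableEq F] (s k : ℕ)
    (C : Submodule F (Fin n → F)) : Prop :=
  ∃ d : ℕ, IsLinearCode k d C ∧ singletonDefect n k d = s ∧
    IsMaximalLength (Fintype.card F) s k n

/-- Deleting the last coordinate of the words of `C'` gives the code `C`. -/
def IsCodeExtension {n : ℕ} {F : Type*} [Field F] (C : Submodule F (Fin n → F))
    (C' : Submodule F (Fin (n + 1) → F)) : Prop :=
  C'.map (LinearMap.funLeft F F (Fin.castSucc : Fin n → Fin (n + 1))) = C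

/-- `C₂` arises from `C₁` by multiplying the last coordinate of all words by a nonzero scalar. -/
def SameUpToLastScaling {n : ℕ} {F : Type*} [Field F]
    (C₁ C₂ : Submodule F (Fin (n + 1) → F)) : Prop :=
  ∃ c : F, c ≠ 0 ∧ ∀ x : Fin (n + 1) → F,
    x ∈ C₁ ↔ Function.update x (Fin.last n) (c * x (Fin.last n)) ∈ C₂

/-! Put `t = s + 1`, `e = k - 3`, and call a hyperplane full if it holds `t + e + 1 = n - d`
members. A length-maximal extension amounts to adjoining a point that lies on no full hyperplane, so
the claim is that exactly one such point exists.

The claim is generalised for induction: every subspace `A` of dimension at most `e + 1` holding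
exactly `finrank F A` members lies in exactly one `W` of dimension one more that is contained in no
full hyperplane (`existsUnique_isExt`). The case `A = ⊥` is the extension point, and the induction
descends from codimension two. In codimension two, a count (`sum_deficiency`) shows that exactly one
hyperplane through `A` is not full. In codimension three, the quotient by `A` is a plane in which
the family behaves like a maximal arc of degree `t + 1` with one point removed. Divisibility of `q`
by `t + 1` puts a tangent (a `t`-secant) through every point; there are `q + 1` tangents, and they
concur in the missing point (`exists_isExt_plane`). In higher codimension, the extensions of `A`
joined to single members are pairwise meeting lines of the quotient, not all in one plane, hence
concurrent (`existsUnique_isExt_step`).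

For systems the family consists of point representatives; for codes, of the coordinate functionals
in the dual of the code. -/

namespace PointFamily

/-! ### Counting a family of vectors over intermediate subspaces. -/

open Module Submodule Finset

variable {F V ι : Type*} [Field F] [AddCommGroup V] [Module F V] [Fintype ι]

open Classical in
/-- The number of members of the family `v` that lie in the subspace `S`. -/
noncomputable def cnt (v : ι → V) (S : Submodule F V) : ℕ :=
  #{i | v i ∈ S}

theorem cnt_mono (v : ι → V) {S T : Submodule F V} (h : S ≤ T) : cnt v S ≤ cnt v T := by
  classical
  exact card_le_card fun i hi => by simp only [mem_filter] at hi ⊢; exact ⟨hi.1, h hi.2⟩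

theorem cnt_lt_cnt (v : ι → V) {S T : Submodule F V} (h : S ≤ T) {i : ι} (hT : v i ∈ T)
    (hS : v i ∉ S) : cnt v S < cnt v T := by
  classical
  refine card_lt_card ⟨fun i hi => by simp only [mem_filter] at hi ⊢; exact ⟨hi.1, h hi.2⟩, ?_⟩
  intro hsub
  have := @hsub i (by simp [hT])
  simp [hS] at this

theorem exists_mem_of_cnt_lt (v : ι → V) {S T : Submodule F V} (h : cnt v S < cnt v T) :
    ∃ i, v i ∈ T ∧ v i ∉ S := by
  classical
  by_contra! hc
  refine h.not_ge (card_le_card fun i hi => ?_)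
  simp only [mem_filter] at hi ⊢
  exact ⟨hi.1, hc i hi.2⟩

theorem exists_notMem_of_cnt_lt (v : ι → V) {S : Submodule F V} (h : cnt v S < Fintype.card ι) :
    ∃ i, v i ∉ S := by
  classical
  by_contra! hc
  refine h.ne ?_
  simp [cnt, hc]

variable [Finite F] [FiniteDimensional F V]

theorem finite_submodule : Finite (Submodule F V) :=
  have : Finite V := Module.finite_of_finite F
  Finite.of_injective (fun S : Submodule F V => (S : Set V)) SetLike.coe_injective

/-- The subspaces between `A` and `B` whose dimension exceeds that of `A` by one. -/
noncomputable def between (A B : Submodule F V) : Finset (Submodule F V) :=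
  have := finite_submodule (F := F) (V := V)
  (Set.toFinite {U : Submodule F V | A ≤ U ∧ U ≤ B ∧ finrank F U = finrank F A + 1}).toFinset

theorem mem_between {A B U : Submodule F V} :
    U ∈ between A B ↔ A ≤ U ∧ U ≤ B ∧ finrank F U = finrank F A + 1 := by
  simp [between]

omit [Finite F] in
theorem eq_sup_span {A U : Submodule F V} {x : V} (hA : A ≤ U)
    (hU : finrank F U = finrank F A + 1) (hx : x ∈ U) (hxA : x ∉ A) : A ⊔ F ∙ x = U :=
  eq_of_le_of_finrank_eq (sup_le hA (by simpa using hx)) (by rw [finrank_sup_span_singleton hxA, hU])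

/-- Double counting: a vector outside `A` lies in exactly one intermediate subspace, its join with
`A`, and a vector of `A` lies in all of them. -/
theorem sum_cnt_between {A B : Submodule F V} (hAB : A ≤ B) (w : ι → V) (hw : ∀ i, w i ∈ B) :
    ∑ U ∈ between A B, cnt w U + cnt w A = Fintype.card ι + #(between A B) * cnt w A := by
  classical
  have h1 : ∑ U ∈ between A B, cnt w U = ∑ i, #{U ∈ between A B | w i ∈ U} := by
    simp only [cnt, card_filter]
    exact sum_comm
  have h2 : ∀ i, #{U ∈ between A B | w i ∈ U} + (if w i ∈ A then 1 else 0) =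
      1 + #(between A B) * (if w i ∈ A then 1 else 0) := by
    intro i
    by_cases hi : w i ∈ A
    · rw [filter_true_of_mem fun U hU => (mem_between.1 hU).1 hi]
      simp [hi]; omega
    · simp only [hi, if_false, add_zero, mul_zero]
      rw [card_eq_one]
      refine ⟨A ⊔ F ∙ w i, ?_⟩
      ext U
      simp only [mem_filter, mem_singleton, mem_between]
      constructor
      · rintro ⟨⟨h1, -, h2⟩, h3⟩
        exact (eq_sup_span h1 h2 h3 hi).symm
      · rintro rfl
        exact ⟨⟨le_sup_left, sup_le hAB (by simpa using hw i), finrank_sup_span_singleton hi⟩,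
          mem_sup_right (mem_span_singleton_self _)⟩
  have h3 := sum_congr (rfl : (univ : Finset ι) = univ) fun i _ => h2 i
  rw [sum_add_distrib, sum_add_distrib, ← h1, ← mul_sum] at h3
  simpa only [cnt, card_filter, sum_const, card_univ, smul_eq_mul, mul_one] using h3

/-- Follows from `sum_cnt_between` for the family of all vectors of `B`, where each count is a power
of `q`. -/
theorem card_between {A B : Submodule F V} (hAB : A ≤ B) (hd : finrank F B = finrank F A + 2) :
    #(between A B) = Nat.card F + 1 := by
  classical
  have : Finite V := Module.finite_of_finite F
  have : Fintype B := Fintype.ofFinite B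
  have key := sum_cnt_between hAB (fun x : B => (x : V)) fun x => x.2
  have hc : ∀ U ≤ B, cnt (fun x : B => (x : V)) U = Nat.card F ^ finrank F U := by
    intro U hU
    rw [← Module.natCard_eq_pow_finrank (K := F) (V := U), cnt, ← Fintype.card_subtype,
      ← Nat.card_eq_fintype_card]
    exact Nat.card_congr
      ⟨fun x => ⟨x.1, x.2⟩, fun x => ⟨⟨x, hU x.2⟩, x.2⟩, fun _ => rfl, fun _ => rfl⟩
  rw [hc A hAB, sum_congr rfl fun U hU =>
    (hc U (mem_between.1 hU).2.1).trans (by rw [(mem_between.1 hU).2.2]),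
    sum_const, smul_eq_mul, ← Nat.card_eq_fintype_card,
    Module.natCard_eq_pow_finrank (K := F) (V := B), hd] at key
  have hq : 1 < Nat.card F := Finite.one_lt_card
  set q := Nat.card F
  set a := finrank F A
  set N := #(between A B)
  have hpos : 0 < q ^ a := by positivity
  have h1 : q ^ a * (N * q + 1) = q ^ a * (q ^ 2 + N) := by
    linear_combination key
  have h2 := Nat.eq_of_mul_eq_mul_left hpos h1
  obtain ⟨p, hp⟩ : ∃ p, q = p + 2 := ⟨q - 2, by omega⟩
  rw [hp] at h2 ⊢
  have h3 : (p + 1) * N = (p + 1) * (p + 3) := by nlinarith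
  have := Nat.eq_of_mul_eq_mul_left (by omega) h3
  omega

/-- A family of `t (q + 1) + e` vectors of an `(e + 3)`-dimensional space with at most `t + e + 1`
members on each hyperplane, where `t + 1` divides `q`. -/
structure NearMaximal (F : Type*) {V ι : Type*} [Field F] [AddCommGroup V] [Module F V]
    [Fintype ι] (v : ι → V) (t e : ℕ) : Prop where
  finrank_eq : finrank F V = e + 3
  card_eq : Fintype.card ι = t * (Nat.card F + 1) + e
  pos : 0 < t
  dvd : t + 1 ∣ Nat.card F
  le : ∀ H : Submodule F V, finrank F H = e + 2 → cnt v H ≤ t + e + 1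

/-! ### Near-maximal families: deficiencies, and extension in codimension two. -/

namespace NearMaximal

variable {v : ι → V} {t e : ℕ}

/-- The basic identity: the `q + 1` hyperplanes through `U` have total deficiency `q (e + 1 - cnt v
U) + 1`. In particular it is `1` when `U` holds `e + 1` members. -/
theorem sum_deficiency (h : NearMaximal F v t e) {U : Submodule F V} (hU : finrank F U = e + 1) :
    ∑ H ∈ between U ⊤, (t + e + 1 - cnt v H) + Nat.card F * cnt v U = Nat.card F * (e + 1) + 1 := by
  have h1 := sum_cnt_between (le_top : U ≤ ⊤) v fun _ => mem_top
  have h2 := card_between (le_top : U ≤ ⊤) (by rw [finrank_top, h.finrank_eq, hU])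
  have h3 : ∑ H ∈ between U ⊤, (t + e + 1 - cnt v H) + ∑ H ∈ between U ⊤, cnt v H
      = (Nat.card F + 1) * (t + e + 1) := by
    rw [← sum_add_distrib, ← h2, ← smul_eq_mul, ← sum_const]
    refine sum_congr rfl fun H hH => Nat.sub_add_cancel (h.le H ?_)
    rw [(mem_between.1 hH).2.2, hU]
  rw [h2, h.card_eq] at h1
  nlinarith

theorem cnt_le (h : NearMaximal F v t e) {U : Submodule F V} (hU : finrank F U = e + 1) :
    cnt v U ≤ e + 1 := by
  have h1 := h.sum_deficiency hU
  have hq : 1 < Nat.card F := Finite.one_lt_card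
  by_contra! hc
  have : Nat.card F * (e + 1 + 1) ≤ Nat.card F * cnt v U := Nat.mul_le_mul_left _ hc
  rw [mul_add_one] at this
  omega

omit [Finite F] in
theorem exists_finrank_eq {A : Submodule F V} {d : ℕ} (h1 : finrank F A ≤ d)
    (h2 : d ≤ finrank F V) : ∃ B, A ≤ B ∧ finrank F B = d := by
  induction d, h1 using Nat.le_induction with
  | base => exact ⟨A, le_rfl, rfl⟩
  | succ d hd ih =>
    obtain ⟨B, hB, hBd⟩ := ih (by omega)
    obtain ⟨x, -, hx⟩ := SetLike.exists_of_lt (show B < ⊤ from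
      lt_top_iff_ne_top.2 fun hc => by rw [hc, finrank_top] at hBd; omega)
    exact ⟨B ⊔ F ∙ x, hB.trans le_sup_left, by rw [finrank_sup_span_singleton hx, hBd]⟩

theorem exists_notMem (h : NearMaximal F v t e) {A : Submodule F V} (hA : finrank F A ≤ e + 2) :
    ∃ i, v i ∉ A := by
  obtain ⟨H, hH, hd⟩ := exists_finrank_eq hA (by rw [h.finrank_eq]; omega)
  refine exists_notMem_of_cnt_lt v ?_
  have := h.le H hd
  have hq : 1 < Nat.card F := Finite.one_lt_card
  have := cnt_mono v hH
  have := h.pos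
  rw [h.card_eq]
  nlinarith

/-- Joining a member outside `A` raises the dimension by one and the count by at least one, so the
bound descends from dimension `e + 1`. -/
theorem cnt_le_finrank (h : NearMaximal F v t e) {A : Submodule F V} (hA : finrank F A ≤ e + 1) :
    cnt v A ≤ finrank F A := by
  induction hn : e + 1 - finrank F A generalizing A with
  | zero =>
    have : finrank F A = e + 1 := by omega
    rw [this]
    exact h.cnt_le this
  | succ n ih =>
    obtain ⟨i, hi⟩ := h.exists_notMem (A := A) (by omega)
    have h1 := finrank_sup_span_singleton hi
    have h2 := ih (A := A ⊔ F ∙ v i) (by omega) (by omega)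
    have h3 := cnt_lt_cnt v (le_sup_left : A ≤ A ⊔ F ∙ v i)
      (mem_sup_right (mem_span_singleton_self _)) hi
    omega

theorem cnt_sup (h : NearMaximal F v t e) {A : Submodule F V} (hA : finrank F A ≤ e)
    (hc : cnt v A = finrank F A) {i : ι} (hi : v i ∉ A) :
    cnt v (A ⊔ F ∙ v i) = finrank F A + 1 := by
  have h1 := finrank_sup_span_singleton hi
  have h2 := h.cnt_le_finrank (A := A ⊔ F ∙ v i) (by omega)
  have h3 := cnt_lt_cnt v (le_sup_left : A ≤ A ⊔ F ∙ v i)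
    (mem_sup_right (mem_span_singleton_self _)) hi
  omega

/-- The extension subspaces of `A`: those subspaces of dimension one more than `A` that lie in no
hyperplane with `t + e + 1` members of the family. -/
def IsExt (v : ι → V) (t e : ℕ) (A W : Submodule F V) : Prop :=
  A ≤ W ∧ finrank F W = finrank F A + 1 ∧
    ∀ H : Submodule F V, W ≤ H → finrank F H = e + 2 → cnt v H ≤ t + e

/-- Enlarge `A` by members up to dimension `e + 1`; then `q + 1` hyperplanes share a total
deficiency of `1`. This serves to show that an extension of `A` gains no members (`IsExt.notMem`).
-/
theorem exists_full (h : NearMaximal F v t e) {A : Submodule F V} (hA : finrank F A ≤ e + 1)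
    (hc : cnt v A = finrank F A) : ∃ H, A ≤ H ∧ finrank F H = e + 2 ∧ cnt v H = t + e + 1 := by
  induction hn : e + 1 - finrank F A generalizing A with
  | zero =>
    have hd : finrank F A = e + 1 := by omega
    have h1 := h.sum_deficiency hd
    have h2 := card_between (le_top : A ≤ ⊤) (by rw [finrank_top, h.finrank_eq, hd])
    have hq : 1 < Nat.card F := Finite.one_lt_card
    by_contra! hcon
    have h3 : #(between A ⊤) • 1 ≤ ∑ H ∈ between A ⊤, (t + e + 1 - cnt v H) := by
      refine card_nsmul_le_sum _ _ _ fun H hH => ?_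
      obtain ⟨h4, -, h5⟩ := mem_between.1 hH
      have := h.le H (by omega)
      have := hcon H h4 (by omega)
      omega
    rw [h2, smul_eq_mul, mul_one] at h3
    rw [hc, hd] at h1
    omega
  | succ n ih =>
    obtain ⟨i, hi⟩ := h.exists_notMem (A := A) (by omega)
    have h1 := finrank_sup_span_singleton hi
    obtain ⟨H, h2, h3⟩ := ih (A := A ⊔ F ∙ v i) (by omega)
      (by rw [h.cnt_sup (by omega) hc hi, h1]) (by omega)
    exact ⟨H, le_sup_left.trans h2, h3⟩

theorem IsExt.notMem (h : NearMaximal F v t e) {A W : Submodule F V} (hA : finrank F A ≤ e)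
    (hc : cnt v A = finrank F A) (hW : IsExt v t e A W) {i : ι} (hi : v i ∉ A) : v i ∉ W := by
  intro hiW
  obtain ⟨h1, h2, h3⟩ := hW
  have h4 := eq_sup_span h1 h2 hiW hi
  obtain ⟨H, h5, h6, h7⟩ := h.exists_full (A := W) (by omega)
    (by rw [← h4, h.cnt_sup hA hc hi, finrank_sup_span_singleton hi])
  have := h3 H h5 h6
  omega

theorem existsUnique_isExt_base (h : NearMaximal F v t e) {A : Submodule F V}
    (hA : finrank F A = e + 1) (hc : cnt v A = e + 1) : ∃! W, IsExt v t e A W := by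
  have h1 := h.sum_deficiency hA
  rw [hc, add_comm, Nat.add_left_cancel_iff] at h1
  obtain ⟨H, hH, hH0⟩ := exists_ne_zero_of_sum_ne_zero (h1.trans_ne one_ne_zero)
  rw [← add_sum_erase _ _ hH] at h1
  have h2 : t + e + 1 - cnt v H = 1 := by omega
  have h3 : ∀ W ∈ between A ⊤, W ≠ H → t + e + 1 - cnt v W = 0 := fun W hW hne =>
    sum_eq_zero_iff.1 (show ∑ x ∈ (between A ⊤).erase H, (t + e + 1 - cnt v x) = 0 by omega) W
      (mem_erase.2 ⟨hne, hW⟩)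
  obtain ⟨h4, -, h5⟩ := mem_between.1 hH
  refine ⟨H, ⟨h4, h5, fun H' h6 h7 => ?_⟩, fun W hW => ?_⟩
  · rw [← eq_of_le_of_finrank_eq h6 (by omega)]
    omega
  · obtain ⟨h6, h7, h8⟩ := hW
    by_contra hne
    have := h3 W (mem_between.2 ⟨h6, le_top, h7⟩) hne
    have := h8 W le_rfl (by omega)
    omega

end NearMaximal

end PointFamily

/-! ### Codimension three: tangents of a punctured maximal arc. -/

namespace PointFamily

open Module Submodule Finset

variable {F V ι : Type*} [Field F] [AddCommGroup V] [Module F V] [FiniteDimensional F V]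

theorem finrank_inf_eq {H K B : Submodule F V} {d : ℕ} (hB : finrank F B ≤ d + 2) (hHB : H ≤ B)
    (hKB : K ≤ B) (hH : finrank F H = d + 1) (hK : finrank F K = d + 1) (hne : H ≠ K) :
    finrank F (H ⊓ K : Submodule F V) = d := by
  have h1 := finrank_sup_add_finrank_inf_eq H K
  have h2 := finrank_mono (sup_le hHB hKB)
  have h3 : H < H ⊔ K := lt_of_le_of_ne le_sup_left fun hc =>
    hne (eq_of_le_of_finrank_eq (sup_eq_left.1 hc.symm) (by omega)).symm
  have h4 := finrank_lt_finrank_of_lt h3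
  omega

variable [Fintype ι] [Finite F]

namespace NearMaximal

variable {v : ι → V} {t e : ℕ}

/-- The hyperplanes through `A` with `t + e` members of the family. -/
noncomputable def tangents (v : ι → V) (t e : ℕ) (A : Submodule F V) : Finset (Submodule F V) :=
  have := finite_submodule (F := F) (V := V)
  (Set.toFinite {H : Submodule F V | A ≤ H ∧ finrank F H = e + 2 ∧ cnt v H = t + e}).toFinset

theorem mem_tangents {A H : Submodule F V} :
    H ∈ tangents v t e A ↔ A ≤ H ∧ finrank F H = e + 2 ∧ cnt v H = t + e := by
  simp [tangents]

theorem cnt_hyperplane (h : NearMaximal F v t e) {A H : Submodule F V} (hA : finrank F A = e)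
    (hc : cnt v A = e) (hAH : A ≤ H) (hH : finrank F H = e + 2) :
    cnt v H = e ∨ cnt v H = t + e ∨ cnt v H = t + e + 1 := by
  rcases (cnt_mono v hAH).eq_or_lt with h1 | h1
  · left; omega
  obtain ⟨i, hi, hiA⟩ := exists_mem_of_cnt_lt v h1
  have h2 := finrank_sup_span_singleton hiA
  have h3 := h.sum_deficiency (U := A ⊔ F ∙ v i) (by omega)
  rw [h.cnt_sup hA.le (by omega) hiA, hA, add_comm, Nat.add_left_cancel_iff] at h3
  have h4 := single_le_sum (f := fun H => t + e + 1 - cnt v H) (fun _ _ => Nat.zero_le _)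
    (mem_between.2 ⟨sup_le hAH (by simpa using hi), le_top, by omega⟩ :
      H ∈ between (A ⊔ F ∙ v i) ⊤)
  have := h.le H hH
  omega

/-- Hyperplanes through `U` have deficiency `0`, `1` (the tangents) or `t + 1`, and the total
deficiency is `1` modulo `q`, hence modulo `t + 1`. -/
theorem card_tangents_modEq (h : NearMaximal F v t e) {A U : Submodule F V}
    (hA : finrank F A = e) (hc : cnt v A = e) (hAU : A ≤ U) (hU : finrank F U = e + 1) :
    #(tangents v t e U) ≡ 1 [MOD t + 1] := by
  classical
  have h1 : tangents v t e U = {H ∈ between U ⊤ | cnt v H = t + e} := by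
    ext H
    simp [mem_tangents, mem_between, hU, and_assoc]
  have h2 : #(tangents v t e U) ≡ ∑ H ∈ between U ⊤, (t + e + 1 - cnt v H) [MOD t + 1] := by
    rw [h1, card_filter]
    refine Nat.ModEq.sum fun H hH => ?_
    obtain ⟨h3, -, h4⟩ := mem_between.1 hH
    have := h.pos
    rcases h.cnt_hyperplane hA hc (hAU.trans h3) (by omega) with h5 | h5 | h5
    · rw [h5, if_neg (by omega), show t + e + 1 - e = t + 1 by omega]
      simp [Nat.ModEq]
    · rw [h5, if_pos rfl, show t + e + 1 - (t + e) = 1 by omega]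
    · rw [h5, if_neg (by omega), Nat.sub_self]
  have h0 : ∀ m, Nat.card F * m ≡ 0 [MOD t + 1] := fun m =>
    (Nat.modEq_zero_iff_dvd).2 (h.dvd.mul_right m)
  have h3 : _ ≡ 0 + 1 [MOD t + 1] := (h0 (e + 1)).add_right 1
  rw [← h.sum_deficiency hU] at h3
  exact h2.trans (((h0 (cnt v U)).symm.add_left _).trans h3)

theorem tangents_nonempty (h : NearMaximal F v t e) {A U : Submodule F V}
    (hA : finrank F A = e) (hc : cnt v A = e) (hAU : A ≤ U) (hU : finrank F U = e + 1) :
    (tangents v t e U).Nonempty := by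
  rw [← card_pos, Nat.pos_iff_ne_zero]
  intro h0
  have h1 := h.card_tangents_modEq hA hc hAU hU
  have := h.pos
  rw [h0, Nat.ModEq, Nat.zero_mod, Nat.mod_eq_of_lt (by omega)] at h1
  omega

theorem card_tangents_sup (h : NearMaximal F v t e) {A : Submodule F V} (hA : finrank F A = e)
    (hc : cnt v A = e) {i : ι} (hi : v i ∉ A) : #(tangents v t e (A ⊔ F ∙ v i)) = 1 := by
  have h1 := finrank_sup_span_singleton hi
  have h2 := h.sum_deficiency (U := A ⊔ F ∙ v i) (by omega)
  rw [h.cnt_sup hA.le (by omega) hi, hA, add_comm, Nat.add_left_cancel_iff] at h2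
  refine le_antisymm ?_ (card_pos.2 (h.tangents_nonempty hA hc le_sup_left (by omega)))
  rw [← h2, card_eq_sum_ones]
  refine (sum_le_sum (g := fun H => t + e + 1 - cnt v H) fun H hH => ?_).trans
    (sum_le_sum_of_subset fun H hH => ?_)
  · have := (mem_tangents.1 hH).2.2
    omega
  · obtain ⟨h3, h4, -⟩ := mem_tangents.1 hH
    exact mem_between.2 ⟨h3, le_top, by omega⟩

/-- Count incident pairs of tangents and members outside `A`: each tangent has `t` such members, and
each of the `t (q + 1)` members is on one tangent. -/
theorem card_tangents (h : NearMaximal F v t e) {A : Submodule F V} (hA : finrank F A = e)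
    (hc : cnt v A = e) : #(tangents v t e A) = Nat.card F + 1 := by
  classical
  have h1 : ∑ H ∈ tangents v t e A, cnt v H = ∑ i, #{H ∈ tangents v t e A | v i ∈ H} := by
    simp only [cnt, card_filter]
    exact sum_comm
  rw [sum_congr rfl fun H hH => (mem_tangents.1 hH).2.2, sum_const, smul_eq_mul] at h1
  have h2 : ∀ i, #{H ∈ tangents v t e A | v i ∈ H} + (if v i ∈ A then 1 else 0) =
      1 + #(tangents v t e A) * (if v i ∈ A then 1 else 0) := by
    intro i
    by_cases hi : v i ∈ A
    · rw [filter_true_of_mem fun U hU => (mem_tangents.1 hU).1 hi]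
      simp only [hi, if_true]; omega
    · simp only [hi, if_false, add_zero, mul_zero]
      rw [← h.card_tangents_sup hA hc hi]
      congr 1
      ext H
      simp only [mem_filter, mem_tangents, sup_le_iff, span_singleton_le_iff_mem]
      tauto
  have h3 := sum_congr (rfl : (univ : Finset ι) = univ) fun i _ => h2 i
  rw [sum_add_distrib, sum_add_distrib, ← h1, ← mul_sum, ← card_filter] at h3
  change _ + cnt v A = _ + _ * cnt v A at h3
  rw [hc, sum_const, card_univ, h.card_eq, smul_eq_mul, mul_one] at h3
  refine Nat.eq_of_mul_eq_mul_left h.pos ?_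
  nlinarith

theorem exists_isExt_plane (h : NearMaximal F v t e) {A : Submodule F V} (hA : finrank F A = e)
    (hc : cnt v A = e) : ∃ W, IsExt v t e A W := by
  classical
  have hV := h.finrank_eq
  have hT := h.card_tangents hA hc
  obtain ⟨T₁, h1, T₂, h2, hne⟩ := one_lt_card.1
    (show 1 < #(tangents v t e A) by
      have : 1 < Nat.card F := Finite.one_lt_card
      omega)
  have hinf : ∀ {H K : Submodule F V}, finrank F H = e + 2 → finrank F K = e + 2 → H ≠ K →
      finrank F (H ⊓ K : Submodule F V) = e + 1 := fun h1 h2 h3 =>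
    finrank_inf_eq (B := ⊤) (by rw [finrank_top]; omega) le_top le_top h1 h2 h3
  obtain ⟨h1A, h1d, h1c⟩ := mem_tangents.1 h1
  obtain ⟨h2A, h2d, h2c⟩ := mem_tangents.1 h2
  have hX := hinf h1d h2d hne
  refine ⟨T₁ ⊓ T₂, le_inf h1A h2A, by omega, fun H hXH hHd => ?_⟩
  by_contra! hH
  have hHT : ∀ K ∈ tangents v t e A, K ≠ H := by
    rintro K hK rfl
    have := (mem_tangents.1 hK).2.2
    omega
  have hAH : A ≤ H := (le_inf h1A h2A).trans hXH
  have hb := card_between hAH (by omega)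
  -- If a full `H` contained `T₁ ⊓ T₂`, then `K ↦ K ⊓ H` would map the `q + 1` tangents onto the `q
  -- + 1` subspaces between `A` and `H`, each of which lies on a tangent. It would be injective, yet
  -- `T₁` and `T₂` have the same image.
  refine hne (inj_on_of_surj_on_of_card_le (s := tangents v t e A) (t := between A H)
    (fun K _ => K ⊓ H) (fun K hK => ?_) (fun U hU => ?_) (by omega) h1 h2 ?_)
  · obtain ⟨h3, h4, -⟩ := mem_tangents.1 hK
    exact mem_between.2 ⟨le_inf h3 hAH, inf_le_right, by rw [hinf h4 hHd (hHT K hK), hA]⟩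
  · obtain ⟨h3, h4, h5⟩ := mem_between.1 hU
    obtain ⟨K, hK⟩ := h.tangents_nonempty hA hc h3 (by omega)
    obtain ⟨h6, h7, h8⟩ := mem_tangents.1 hK
    have hKA : K ∈ tangents v t e A := mem_tangents.2 ⟨h3.trans h6, h7, h8⟩
    refine ⟨K, hKA, (eq_of_le_of_finrank_eq (le_inf h6 h4) ?_).symm⟩
    rw [hinf h7 hHd (hHT K hKA)]
    omega
  · have h3 : T₁ ⊓ T₂ = T₁ ⊓ H := eq_of_le_of_finrank_eq (le_inf inf_le_left hXH) (by
      rw [hX, hinf h1d hHd (hHT _ h1)])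
    have h4 : T₁ ⊓ T₂ = T₂ ⊓ H := eq_of_le_of_finrank_eq (le_inf inf_le_right hXH) (by
      rw [hX, hinf h2d hHd (hHT _ h2)])
    exact h3.symm.trans h4

/-- All `q + 1` hyperplanes through `W` are deficient, so `sum_deficiency` forces `cnt v W = e` and
every deficiency to be `1`. Hence `W` is determined as the intersection of any two tangents. -/
theorem IsExt.between_eq_tangents (h : NearMaximal F v t e) {A W : Submodule F V}
    (hA : finrank F A = e) (hc : cnt v A = e) (hW : IsExt v t e A W) :
    between W ⊤ = tangents v t e A := by
  obtain ⟨h1, h2, h3⟩ := hW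
  have hd := h.sum_deficiency (U := W) (by omega)
  have hcW := h.cnt_le_finrank (A := W) (by omega)
  have hb := card_between (le_top : W ≤ ⊤) (by rw [finrank_top, h.finrank_eq]; omega)
  have hge : ∀ H ∈ between W ⊤, 1 ≤ t + e + 1 - cnt v H := fun H hH => by
    obtain ⟨h4, -, h5⟩ := mem_between.1 hH
    have := h3 H h4 (by omega)
    omega
  have hsum := card_nsmul_le_sum _ _ 1 hge
  rw [hb, smul_eq_mul, mul_one] at hsum
  have hq : 1 < Nat.card F := Finite.one_lt_card
  have hcW' : cnt v W = e := by
    refine le_antisymm ?_ (hc.symm.le.trans (cnt_mono v h1))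
    by_contra! hlt
    rw [show cnt v W = e + 1 by omega] at hd
    omega
  rw [hcW', mul_add_one] at hd
  have hsum' : ∑ H ∈ between W ⊤, 1 = ∑ H ∈ between W ⊤, (t + e + 1 - cnt v H) := by
    rw [sum_const, hb, smul_eq_mul]
    omega
  have hone := (sum_eq_sum_iff_of_le hge).1 hsum'
  refine eq_of_subset_of_card_le (fun H hH => ?_) (by rw [hb, h.card_tangents hA hc])
  obtain ⟨h4, -, h5⟩ := mem_between.1 hH
  have := hone H hH
  exact mem_tangents.2 ⟨h1.trans h4, by omega, by omega⟩

theorem existsUnique_isExt_plane (h : NearMaximal F v t e) {A : Submodule F V}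
    (hA : finrank F A = e) (hc : cnt v A = e) : ∃! W, IsExt v t e A W := by
  obtain ⟨W, hW⟩ := h.exists_isExt_plane hA hc
  refine ⟨W, hW, fun W' hW' => ?_⟩
  have hV := h.finrank_eq
  have h1 := (IsExt.between_eq_tangents h hA hc hW').trans
    (IsExt.between_eq_tangents h hA hc hW).symm
  have hb := card_between (le_top : W ≤ ⊤) (by
    have := hW.2.1
    rw [finrank_top]
    omega)
  obtain ⟨H, hH, K, hK, hne⟩ := one_lt_card.1 (show 1 < #(between W ⊤) by
      have : 1 < Nat.card F := Finite.one_lt_card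
      omega)
  have hWd := hW.2.1
  have hH' := mem_between.1 (h1 ▸ hH)
  have hK' := mem_between.1 (h1 ▸ hK)
  rw [mem_between] at hH hK
  have h2 := finrank_inf_eq (B := ⊤) (d := e + 1) (by rw [finrank_top]; omega) le_top le_top
    (by omega : finrank F H = _) (by omega : finrank F K = _) hne
  have h3 : W = H ⊓ K := eq_of_le_of_finrank_eq (le_inf hH.1 hK.1) (by omega)
  have hWd' := hW'.2.1
  have h4 : W' = H ⊓ K := eq_of_le_of_finrank_eq (le_inf hH'.1 hK'.1) (by omega)
  rw [h3, h4]

end NearMaximal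

end PointFamily

/-! ### Higher codimension: concurrent lines in the quotient by `A`. -/

namespace PointFamily

open Module Submodule Finset

variable {F V ι : Type*} [Field F] [AddCommGroup V] [Module F V] [FiniteDimensional F V]
  [Fintype ι] [Finite F]

namespace NearMaximal

variable {v : ι → V} {t e : ℕ}

omit [Finite F] in
theorem IsExt.sup {A W : Submodule F V} {x : V} (hW : IsExt v t e A W) (hx : x ∉ W) :
    IsExt v t e (A ⊔ F ∙ x) (W ⊔ F ∙ x) := by
  obtain ⟨h1, h2, h3⟩ := hW
  refine ⟨sup_le_sup_right h1 _, ?_, fun H hH => h3 H (le_sup_left.trans hH)⟩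
  rw [finrank_sup_span_singleton hx, finrank_sup_span_singleton fun hc => hx (h1 hc), h2]

theorem existsUnique_isExt_step (h : NearMaximal F v t e) {A : Submodule F V}
    (hA : finrank F A + 1 ≤ e) (hc : cnt v A = finrank F A)
    (ih : ∀ B : Submodule F V, finrank F A < finrank F B → finrank F B ≤ e + 1 →
      cnt v B = finrank F B → ∃! W, IsExt v t e B W) : ∃! W, IsExt v t e A W := by
  have hex : ∀ i, ∃ W, v i ∉ A → IsExt v t e (A ⊔ F ∙ v i) W ∧
      ∀ W', IsExt v t e (A ⊔ F ∙ v i) W' → W' = W := by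
    intro i
    by_cases hi : v i ∈ A
    -- A junk value, so that `W` is a total function of the index.
    · exact ⟨A, fun hc => absurd hi hc⟩
    · have hd := finrank_sup_span_singleton hi
      obtain ⟨W, hW⟩ := ih (A ⊔ F ∙ v i) (by omega) (by omega)
        (by rw [h.cnt_sup (by omega) hc hi, hd])
      exact ⟨W, fun _ => hW⟩
  choose W hW using hex
  have hmem : ∀ {x : V} {B : Submodule F V}, x ∈ B ⊔ F ∙ x := fun {x B} =>
    mem_sup_right (mem_span_singleton_self x)
  have hdA : ∀ {i}, v i ∉ A → finrank F (A ⊔ F ∙ v i : Submodule F V) = finrank F A + 1 :=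
    fun hi => finrank_sup_span_singleton hi
  have hcA : ∀ {i}, v i ∉ A → cnt v (A ⊔ F ∙ v i) = finrank F A + 1 :=
    fun hi => h.cnt_sup (by omega) hc hi
  have hdW : ∀ {i}, v i ∉ A → finrank F (W i) = finrank F A + 2 := fun {i} hi => by
    rw [(hW i hi).1.2.1, hdA hi]
  have hAW : ∀ {i}, v i ∉ A → A ≤ W i := fun {i} hi => le_sup_left.trans (hW i hi).1.1
  have hvW : ∀ {i}, v i ∉ A → v i ∈ W i := fun {i} hi => (hW i hi).1.1 hmem
  have hnot : ∀ {i j}, v i ∉ A → v j ∉ A ⊔ F ∙ v i → v j ∉ W i := fun {i j} hi hj =>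
    IsExt.notMem h (by rw [hdA hi]; omega) (by rw [hcA hi, hdA hi]) (hW i hi).1 hj
  have hsymm : ∀ {i j}, v i ∉ A → v j ∉ A ⊔ F ∙ v i → v i ∉ A ⊔ F ∙ v j := by
    intro i j hi hj hij
    have hjA : v j ∉ A := fun hc => hj (mem_sup_left hc)
    exact hj (eq_sup_span le_sup_left (hdA hjA) hij hi ▸ hmem)
  have hpair : ∀ {i j}, v i ∉ A → v j ∉ A ⊔ F ∙ v i →
      ∃ B, W i ≤ B ∧ W j ≤ B ∧ finrank F B = finrank F A + 3 ∧
        finrank F (W i ⊓ W j : Submodule F V) = finrank F A + 1 := by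
    intro i j hi hj
    have hjA : v j ∉ A := fun hc => hj (mem_sup_left hc)
    have hjW := hnot hi hj
    have h1 := (hW i hi).1.sup hjW
    have h2 := (hW j hjA).1.sup (hnot hjA (hsymm hi hj))
    rw [sup_right_comm] at h2
    have hd : finrank F (A ⊔ F ∙ v i ⊔ F ∙ v j : Submodule F V) = finrank F A + 2 := by
      rw [finrank_sup_span_singleton hj, hdA hi]
    -- `W i ⊔ F ∙ v j` and `W j ⊔ F ∙ v i` both extend `A ⊔ F ∙ v i ⊔ F ∙ v j`, so they coincide;
    -- modulo `A` this is a plane containing the lines `W i` and `W j`.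
    have h3 := (ih (A ⊔ F ∙ v i ⊔ F ∙ v j) (by omega) (by omega)
      (by rw [h.cnt_sup (by rw [hdA hi]; omega) (by rw [hcA hi, hdA hi]) hj, hd, hdA hi])).unique
        h1 h2
    have hB : finrank F (W i ⊔ F ∙ v j : Submodule F V) = finrank F A + 3 := by
      rw [finrank_sup_span_singleton hjW, hdW hi]
    refine ⟨W i ⊔ F ∙ v j, le_sup_left, h3 ▸ le_sup_left, hB, ?_⟩
    refine finrank_inf_eq hB.le le_sup_left (h3 ▸ le_sup_left) (hdW hi) (hdW hjA) fun hc => ?_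
    exact hjW (hc ▸ hvW hjA)
  -- Modulo `A`, the line `W l` leaves the plane `B`, so it meets `B` in one point, which must lie
  -- on both `W i` and `W j`.
  have hthree : ∀ {i j l B}, v i ∉ A → v j ∉ A ⊔ F ∙ v i → W i ≤ B → W j ≤ B → v l ∉ B →
      W i ⊓ W j ≤ W l := by
    intro i j l B hi hj hiB hjB hl
    have hjA : v j ∉ A := fun hc => hj (mem_sup_left hc)
    have hli : v l ∉ A ⊔ F ∙ v i := fun hc => hl (hiB ((hW i hi).1.1 hc))
    have hlj : v l ∉ A ⊔ F ∙ v j := fun hc => hl (hjB ((hW j hjA).1.1 hc))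
    have hlA : v l ∉ A := fun hc => hli (mem_sup_left hc)
    obtain ⟨-, -, -, -, h1⟩ := hpair hi hj
    obtain ⟨-, -, -, -, h2⟩ := hpair hi hli
    obtain ⟨-, -, -, -, h3⟩ := hpair hjA hlj
    have hlt : B ⊓ W l < W l := lt_of_le_of_ne inf_le_right fun hc =>
      hl ((inf_eq_right.1 hc) (hvW hlA))
    have h4 := finrank_lt_finrank_of_lt hlt
    rw [hdW hlA] at h4
    have h5 : W i ⊓ W l = B ⊓ W l :=
      eq_of_le_of_finrank_le (inf_le_inf_right _ hiB) (by omega)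
    have h6 : W j ⊓ W l = B ⊓ W l :=
      eq_of_le_of_finrank_le (inf_le_inf_right _ hjB) (by omega)
    have h7 : W i ⊓ W l = W i ⊓ W j :=
      eq_of_le_of_finrank_eq (le_inf inf_le_left ((h5.trans h6.symm).le.trans inf_le_left))
        (by omega)
    exact h7 ▸ inf_le_right
  have hV := h.finrank_eq
  obtain ⟨i, hi⟩ := h.exists_notMem (A := A) (by omega)
  obtain ⟨j, hj⟩ := h.exists_notMem (A := A ⊔ F ∙ v i) (by rw [hdA hi]; omega)
  have hjA : v j ∉ A := fun hc => hj (mem_sup_left hc)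
  obtain ⟨B, hiB, hjB, hB, hX⟩ := hpair hi hj
  have hall : ∀ {l}, v l ∉ A → W i ⊓ W j ≤ W l := by
    intro l hl
    by_cases hlB : v l ∉ B
    · exact hthree hi hj hiB hjB hlB
    push Not at hlB
    -- For `v l` in `B`, replace `j` by some `m` outside `B` with the same intersection point. The
    -- planes `B` and `B'` share only `W i`, so one of them misses `v l` unless `W l = W i`.
    obtain ⟨m, hm⟩ := h.exists_notMem (A := B) (by omega)
    have hmi : v m ∉ A ⊔ F ∙ v i := fun hc => hm (hiB ((hW i hi).1.1 hc))
    have hmA : v m ∉ A := fun hc => hmi (mem_sup_left hc)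
    obtain ⟨B', hiB', hmB', hB', hX'⟩ := hpair hi hmi
    have h1 : W i ⊓ W j = W i ⊓ W m := eq_of_le_of_finrank_eq
      (le_inf inf_le_left (hthree hi hj hiB hjB hm)) (by omega)
    by_cases hlB' : v l ∉ B'
    · exact h1 ▸ hthree hi hmi hiB' hmB' hlB'
    push Not at hlB'
    have hlt : B ⊓ B' < B' := lt_of_le_of_ne inf_le_right fun hc =>
      hm ((inf_eq_right.1 hc) (hmB' (hvW hmA)))
    have h2 := finrank_lt_finrank_of_lt hlt
    have h3 : W i = B ⊓ B' := eq_of_le_of_finrank_le (le_inf hiB hiB') (by rw [hdW hi]; omega)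
    have hli : v l ∈ W i := h3 ▸ mem_inf.2 ⟨hlB, hlB'⟩
    have hli' : v l ∈ A ⊔ F ∙ v i := by
      by_contra hc
      exact hnot hi hc hli
    have h4 := (hW l hl).1
    rw [eq_sup_span le_sup_left (hdA hi) hli' hl] at h4
    rw [(hW i hi).2 _ h4]
    exact inf_le_left
  have hAX : A ≤ W i ⊓ W j := le_inf (hAW hi) (hAW hjA)
  have hlX : ∀ {l}, v l ∉ A → v l ∉ W i ⊓ W j := by
    intro l hl hlX
    obtain ⟨m, hm⟩ := h.exists_notMem (A := A ⊔ F ∙ v l) (by rw [hdA hl]; omega)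
    exact hnot (fun hc => hm (mem_sup_left hc)) (hsymm hl hm)
      (hall (fun hc => hm (mem_sup_left hc)) hlX)
  refine ⟨W i ⊓ W j, ⟨hAX, hX, fun H hXH hH => ?_⟩, fun Y hY => ?_⟩
  -- A full hyperplane through the common point contains a member `v l` outside `A`, hence all of `W
  -- l`, which is impossible.
  · by_contra! hlt
    obtain ⟨l, hlH, hlA⟩ := exists_mem_of_cnt_lt v (show cnt v A < cnt v H by omega)
    have h1 : W i ⊓ W j ⊔ F ∙ v l = W l := eq_of_le_of_finrank_eq
      (sup_le (hall hlA) (by simpa using hvW hlA))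
      (by rw [finrank_sup_span_singleton (hlX hlA), hX, hdW hlA])
    have h2 := (hW l hlA).1.2.2 H (h1 ▸ sup_le hXH (by simpa using hlH)) hH
    omega
  -- A second extension `Y` would satisfy `Y ⊔ W i ⊓ W j = W l` for every `l` outside `A`, making
  -- all the lines `W l` equal.
  · by_contra hne
    have hYd := hY.2.1
    have hYW : ∀ {l}, v l ∉ A → Y ⊔ F ∙ v l = W l := fun {l} hl =>
      (hW l hl).2 _ (hY.sup (IsExt.notMem h (by omega) hc hY hl))
    have hlt : W i ⊓ W j < Y ⊔ W i ⊓ W j := lt_of_le_of_ne le_sup_right fun hc =>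
      hne (eq_of_le_of_finrank_eq (sup_eq_right.1 hc.symm) (by omega))
    have h1 := finrank_lt_finrank_of_lt hlt
    obtain ⟨l, hl⟩ := h.exists_notMem (A := W i) (by rw [hdW hi]; omega)
    have hYX : ∀ {l}, v l ∉ A → Y ⊔ W i ⊓ W j = W l := fun {l} hl =>
      eq_of_le_of_finrank_le (sup_le (hYW hl ▸ le_sup_left) (hall hl)) (by rw [hdW hl]; omega)
    have hlA : v l ∉ A := fun hc => hl (hAW hi hc)
    exact hl ((hYX hi).symm.trans (hYX hlA) ▸ hvW hlA)

theorem existsUnique_isExt (h : NearMaximal F v t e) {A : Submodule F V}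
    (hA : finrank F A ≤ e + 1) (hc : cnt v A = finrank F A) : ∃! W, IsExt v t e A W := by
  induction hn : e + 1 - finrank F A using Nat.strong_induction_on generalizing A with
  | _ n ih =>
    obtain h1 | h1 | h1 : finrank F A = e + 1 ∨ finrank F A = e ∨ finrank F A + 1 ≤ e := by omega
    · exact h.existsUnique_isExt_base h1 (hc.trans h1)
    · exact h.existsUnique_isExt_plane h1 (hc.trans h1)
    · exact h.existsUnique_isExt_step h1 hc fun B hB hBe hcB => ih _ (by omega) hBe hcB rfl

/-- A near-maximal family has exactly one extension point. -/
theorem existsUnique_extension_point (h : NearMaximal F v t e) :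
    ∃! W : Submodule F V, finrank F W = 1 ∧
      ∀ H : Submodule F V, W ≤ H → finrank F H = e + 2 → cnt v H ≤ t + e := by
  -- No member is the zero vector, so `A = ⊥` meets the counting condition.
  have h1 := h.cnt_le_finrank (A := (⊥ : Submodule F V)) (by simp)
  have h2 : finrank F (⊥ : Submodule F V) = 0 := finrank_bot F V
  simpa [IsExt, h2] using h.existsUnique_isExt (A := ⊥) (by omega) (by omega)

end NearMaximal

end PointFamily

/-! ### Projective systems. -/

namespace PointFamily

open Module Submodule Finset

variable {F : Type*} [Field F]

theorem submodule_le_iff_rep_mem {k : ℕ} (P : PG k F) (H : Submodule F (Fin k → F)) :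
    P.submodule ≤ H ↔ P.rep ∈ H := by
  rw [Projectivization.submodule_eq, span_singleton_le_iff_mem]

open Classical in
theorem cnt_rep_eq_pointsOn {k : ℕ} (G : Multiset (PG k F)) (H : Submodule F (Fin k → F)) :
    cnt (fun x : G.ToType => (x : PG k F).rep) H = pointsOn G H := by
  classical
  unfold pointsOn cnt
  conv_rhs => rw [← Multiset.map_univ_coe G]
  rw [Multiset.countP_map, card_def, filter_val]
  simp only [submodule_le_iff_rep_mem]

theorem pointsOn_cons_of_le {k : ℕ} (G : Multiset (PG k F)) {P : PG k F}
    {H : Submodule F (Fin k → F)} (h : P.submodule ≤ H) :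
    pointsOn (P ::ₘ G) H = pointsOn G H + 1 := by
  classical
  exact Multiset.countP_cons_of_pos (p := fun P : PG k F => P.submodule ≤ H) G h

theorem pointsOn_cons_of_not_le {k : ℕ} (G : Multiset (PG k F)) {P : PG k F}
    {H : Submodule F (Fin k → F)} (h : ¬ P.submodule ≤ H) :
    pointsOn (P ::ₘ G) H = pointsOn G H := by
  classical
  exact Multiset.countP_cons_of_neg (p := fun P : PG k F => P.submodule ≤ H) G h

theorem existsUnique_lengthMaximalSystem [Fintype F] {n d s e : ℕ}
    (hdvd : s + 2 ∣ Fintype.card F) (hn : n = (s + 1) * (Fintype.card F + 1) + e)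
    (hd : s + e + 2 + d = n) {G : Multiset (PG (e + 3) F)} (hG : IsProjectiveSystem n d G) :
    ∃! G' : Multiset (PG (e + 3) F), G ≤ G' ∧ IsLengthMaximalSystem s G' := by
  classical
  obtain ⟨hcard, r, hr, ⟨H₀, hH₀, hH₀r⟩, hmax⟩ := hG
  obtain rfl : r = s + e + 2 := by omega
  have hle : ∀ H : Submodule F (Fin (e + 3) → F), finrank F H = e + 2 →
      pointsOn G H ≤ s + e + 2 := fun H hH => hmax ⟨H, by rw [IsHyperplane, hH], rfl⟩
  have h : NearMaximal F (fun x : G.ToType => (x : PG (e + 3) F).rep) (s + 1) e :=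
    { finrank_eq := by simp
      card_eq := by rw [Multiset.card_coe, hcard, hn, Nat.card_eq_fintype_card]
      pos := s.succ_pos
      dvd := by rwa [Nat.card_eq_fintype_card]
      le := fun H hH => by
        rw [cnt_rep_eq_pointsOn]
        exact (hle H hH).trans (by omega) }
  obtain ⟨W, ⟨hW, hWle⟩, hWuniq⟩ := h.existsUnique_extension_point
  simp only [cnt_rep_eq_pointsOn] at hWle hWuniq
  have hX := Projectivization.submodule_mk'' W hW
  set X : PG (e + 3) F := Projectivization.mk'' W hW
  refine ⟨X ::ₘ G, ⟨Multiset.le_cons_self G X, n + 1, d + 1, ⟨by rw [Multiset.card_cons, hcard],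
    s + e + 2, by omega, ⟨H₀, hH₀, ?_⟩, ?_⟩, ?_, ?_⟩, ?_⟩
  -- `H₀` is full, so it misses `X` and still attains the maximum.
  · rw [pointsOn_cons_of_not_le, hH₀r]
    intro hc
    have := hWle H₀ (hX ▸ hc) (Nat.add_right_cancel hH₀)
    omega
  · rintro m ⟨H, hH, rfl⟩
    have hH' : finrank F H = e + 2 := Nat.add_right_cancel hH
    by_cases hXH : X.submodule ≤ H
    · rw [pointsOn_cons_of_le _ hXH]
      have := hWle H (hX ▸ hXH) hH'
      omega
    · rw [pointsOn_cons_of_not_le _ hXH]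
      exact hle H hH'
  · simp only [singletonDefect]
    omega
  · simp only [IsMaximalLength, hn]
    push_cast
    ring
  · rintro G' ⟨hGG', n', d', ⟨hcard', r', hr', -, hmax'⟩, hdef, hlen⟩
    -- Length and defect force one additional point `Y` and the same maximum `s + e + 2`, so no full
    -- hyperplane of `G` passes through `Y`.
    have hn' : n' = n + 1 := by
      simp only [IsMaximalLength] at hlen
      zify
      rw [hlen, hn]
      push_cast
      ring
    subst hn'
    simp only [singletonDefect] at hdef
    obtain rfl : r' = s + e + 2 := by omega
    obtain ⟨u, rfl⟩ := Multiset.le_iff_exists_add.1 hGG'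
    rw [Multiset.card_add, hcard, Nat.add_left_cancel_iff, Multiset.card_eq_one] at hcard'
    obtain ⟨Y, rfl⟩ := hcard'
    rw [add_comm G, Multiset.singleton_add] at hmax' ⊢
    have hY := hWuniq Y.submodule ⟨Y.finrank_submodule, fun H hYH hH => by
      have := hmax' ⟨H, by rw [IsHyperplane, hH], rfl⟩
      rw [pointsOn_cons_of_le _ hYH] at this
      omega⟩
    rw [Projectivization.submodule_injective (hY.trans hX.symm)]

theorem exists_eq_span_singleton {V : Type*} [AddCommGroup V] [Module F V] {W : Submodule F V}
    (hW : finrank F W = 1) : ∃ x, W = F ∙ x := by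
  obtain ⟨⟨x, hx⟩, -, hspan⟩ := finrank_eq_one_iff'.1 hW
  refine ⟨x, le_antisymm (fun y hy => ?_) (by simpa using hx)⟩
  obtain ⟨c, hc⟩ := hspan ⟨y, hy⟩
  exact mem_span_singleton.2 ⟨c, congrArg Subtype.val hc⟩

/-! ### Linear codes, through their coordinate functionals. -/

section Codes

variable {n : ℕ}

/-- The coordinate functionals of a code. -/
def coords (C : Submodule F (Fin n → F)) (j : Fin n) : Dual F C :=
  (LinearMap.proj j).comp C.subtype

/-- The map adjoining to each word of `C` the value of `φ` as a last coordinate. -/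
def snocMap (C : Submodule F (Fin n → F)) (φ : Dual F C) : C →ₗ[F] (Fin (n + 1) → F) where
  toFun x := Fin.snoc (α := fun _ => F) (x : Fin n → F) (φ x)
  map_add' x y := by
    ext j
    refine Fin.lastCases ?_ (fun j => ?_) j <;> simp
  map_smul' c x := by
    ext j
    refine Fin.lastCases ?_ (fun j => ?_) j <;> simp

@[simp]
theorem snocMap_last (C : Submodule F (Fin n → F)) (φ : Dual F C) (x : C) :
    snocMap C φ x (Fin.last n) = φ x := by
  simp [snocMap]

@[simp]
theorem snocMap_castSucc (C : Submodule F (Fin n → F)) (φ : Dual F C) (x : C) (j : Fin n) :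
    snocMap C φ x j.castSucc = (x : Fin n → F) j := by
  simp [snocMap]

theorem snocMap_injective (C : Submodule F (Fin n → F)) (φ : Dual F C) :
    Function.Injective (snocMap C φ) := fun x y h => by
  ext j
  simpa using congrFun h j.castSucc

theorem isCodeExtension_range_snocMap (C : Submodule F (Fin n → F)) (φ : Dual F C) :
    IsCodeExtension C (LinearMap.range (snocMap C φ)) := by
  rw [IsCodeExtension, ← LinearMap.range_comp]
  convert C.range_subtype
  ext x j
  simp [LinearMap.funLeft]

/-- Equal dimensions make deletion of the last coordinate bijective from `C'` to `C`, so the last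
coordinate is a linear functional of the shortened word. -/
theorem eq_range_snocMap {C : Submodule F (Fin n → F)} {C' : Submodule F (Fin (n + 1) → F)}
    (h : IsCodeExtension C C') (hd : finrank F C' = finrank F C) :
    ∃ φ, C' = LinearMap.range (snocMap C φ) := by
  set g := LinearMap.funLeft F F (Fin.castSucc : Fin n → Fin (n + 1))
  have hg : ∀ y ∈ C', g y ∈ C := fun y hy => h ▸ mem_map_of_mem hy
  set f : C' →ₗ[F] C := g.restrict hg
  have hsurj : Function.Surjective f := by
    rintro ⟨x, hx⟩
    rw [← h] at hx
    obtain ⟨y, hy, rfl⟩ := hx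
    exact ⟨⟨y, hy⟩, rfl⟩
  have hinj : Function.Injective f :=
    (LinearMap.injective_iff_surjective_of_finrank_eq_finrank hd).2 hsurj
  set E := LinearEquiv.ofBijective f ⟨hinj, hsurj⟩
  refine ⟨(LinearMap.proj (Fin.last n)).comp (C'.subtype.comp E.symm.toLinearMap), ?_⟩
  have key : ∀ y : C', snocMap C ((LinearMap.proj (Fin.last n)).comp
      (C'.subtype.comp E.symm.toLinearMap)) (E y) = y := by
    intro y
    ext j
    refine Fin.lastCases ?_ (fun j => ?_) j
    · simp
    · simp only [snocMap_castSucc]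
      rfl
  ext z
  constructor
  · intro hz
    exact ⟨_, key ⟨z, hz⟩⟩
  · rintro ⟨x, rfl⟩
    obtain ⟨y, rfl⟩ := E.surjective x
    rw [key]
    exact y.2

variable [DecidableEq F]

theorem isLinearCode_iff {k d : ℕ} {C : Submodule F (Fin n → F)} :
    IsLinearCode k d C ↔ finrank F C = k ∧ (∃ x ∈ C, x ≠ 0 ∧ hammingNorm x = d) ∧
      ∀ x ∈ C, x ≠ 0 → d ≤ hammingNorm x := by
  refine and_congr_right fun _ => and_congr ⟨?_, ?_⟩ ⟨?_, ?_⟩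
  · rintro ⟨x, hx, y, hy, hne, rfl⟩
    exact ⟨-x + y, add_mem (neg_mem hx) hy, mt neg_add_eq_zero.1 hne, (hammingDist_eq_hammingNorm x y).symm⟩
  · rintro ⟨x, hx, hne, rfl⟩
    exact ⟨x, hx, 0, zero_mem _, hne, hammingDist_zero_right x⟩
  · exact fun h x hx hne => h ⟨x, hx, 0, zero_mem _, hne, hammingDist_zero_right x⟩
  · rintro h _ ⟨x, hx, y, hy, hne, rfl⟩
    rw [hammingDist_eq_hammingNorm]
    exact h _ (add_mem (neg_mem hx) hy) (mt neg_add_eq_zero.1 hne)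

theorem hammingNorm_snocMap (C : Submodule F (Fin n → F)) (φ : Dual F C) (x : C) :
    hammingNorm (snocMap C φ x) = hammingNorm (x : Fin n → F) + if φ x = 0 then 0 else 1 := by
  simp only [hammingNorm, card_filter, Fin.sum_univ_castSucc, snocMap_last, snocMap_castSucc,
    ne_eq, ite_not]

/-- Dictionary: a hyperplane of the dual is the set of functionals vanishing at a nonzero word, and
its members are the zero coordinates of that word. Full hyperplanes thus correspond to words of
weight `d`. -/
theorem cnt_coords_add_hammingNorm {C : Submodule F (Fin n → F)} {H : Submodule F (Dual F C)}
    {x : C} (hx : ∀ φ, φ ∈ H ↔ φ x = 0) : cnt (coords C) H + hammingNorm (x : Fin n → F) = n := by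
  classical
  have h := card_filter_add_card_filter_not (s := (univ : Finset (Fin n)))
    (fun j => (x : Fin n → F) j = 0)
  rw [card_univ, Fintype.card_fin] at h
  simp only [cnt, hx, hammingNorm]
  exact h

omit [DecidableEq F] in
theorem exists_mem_iff_apply_eq_zero {V : Type*} [AddCommGroup V] [Module F V]
    [FiniteDimensional F V] {H : Submodule F (Dual F V)} (hH : finrank F H + 1 = finrank F V) :
    ∃ x : V, x ≠ 0 ∧ ∀ φ, φ ∈ H ↔ φ x = 0 := by
  have h1 := Subspace.finrank_add_finrank_dualCoannihilator_eq H
  have h2 : finrank F H.dualCoannihilator = 1 := by omega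
  obtain ⟨⟨x, hx⟩, hne, hspan⟩ := finrank_eq_one_iff'.1 h2
  refine ⟨x, fun hc => hne (by ext; exact hc), fun φ => ⟨fun hφ => ?_, fun hφ => ?_⟩⟩
  · exact (mem_dualCoannihilator x).1 hx φ hφ
  · rw [← Subspace.dualCoannihilator_dualAnnihilator_eq (W := H), mem_dualAnnihilator]
    intro w hw
    obtain ⟨c, hc⟩ := hspan ⟨w, hw⟩
    have : c • x = w := congrArg Subtype.val hc
    rw [← this, map_smul, hφ, smul_zero]

omit [DecidableEq F] in
theorem finrank_ker_eval {V : Type*} [AddCommGroup V] [Module F V]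
    [FiniteDimensional F V] {x : V} (hx : x ≠ 0) :
    finrank F (LinearMap.ker (Dual.eval F V x)) + 1 = finrank F V := by
  rw [Module.Dual.finrank_ker_add_one_of_ne_zero (f := Dual.eval F V x), Subspace.dual_finrank_eq]
  intro hc
  exact hx ((forall_dual_apply_eq_zero_iff F x).1 fun φ => LinearMap.congr_fun hc φ)

variable [Fintype F] {d s e : ℕ} {C : Submodule F (Fin n → F)}

theorem nearMaximal_coords (hdvd : s + 2 ∣ Fintype.card F)
    (hn : n = (s + 1) * (Fintype.card F + 1) + e) (hd : s + e + 2 + d = n)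
    (hC : IsLinearCode (e + 3) d C) : NearMaximal F (coords C) (s + 1) e where
  finrank_eq := by rw [Subspace.dual_finrank_eq, hC.1]
  card_eq := by rw [Fintype.card_fin, hn, Nat.card_eq_fintype_card]
  pos := s.succ_pos
  dvd := by rwa [Nat.card_eq_fintype_card]
  le := fun H hH => by
    obtain ⟨x, hx, hxH⟩ := exists_mem_iff_apply_eq_zero (V := C) (H := H) (by rw [hH, hC.1])
    have h1 := cnt_coords_add_hammingNorm hxH
    have h2 := (isLinearCode_iff.1 hC).2.2 x x.2 (by simpa using hx)
    omega

omit [Fintype F] in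
theorem forall_cnt_le_iff (hd : s + e + 2 + d = n) (hC : IsLinearCode (e + 3) d C)
    (φ : Dual F C) :
    (∀ H, F ∙ φ ≤ H → finrank F H = e + 2 → cnt (coords C) H ≤ s + 1 + e) ↔
      ∀ x : C, x ≠ 0 → φ x = 0 → d + 1 ≤ hammingNorm (x : Fin n → F) := by
  constructor
  · intro h x hx hφ
    have h1 := cnt_coords_add_hammingNorm (C := C) (H := LinearMap.ker (Dual.eval F C x)) (x := x)
      fun ψ => by simp
    have h2 := finrank_ker_eval (F := F) hx
    rw [hC.1] at h2
    have h3 := h (LinearMap.ker (Dual.eval F C x)) (by simpa using hφ) (by omega)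
    omega
  · intro h H hφH hH
    obtain ⟨x, hx, hxH⟩ := exists_mem_iff_apply_eq_zero (V := C) (H := H) (by rw [hH, hC.1])
    have h1 := cnt_coords_add_hammingNorm hxH
    have h2 := h x hx ((hxH φ).1 (by simpa using hφH))
    omega

/-- The minimum distance must rise to `d + 1`, that is, `φ` must be nonzero on every word of weight
`d`. -/
theorem isLengthMaximalCode_range_snocMap_iff (hn : n = (s + 1) * (Fintype.card F + 1) + e)
    (hd : s + e + 2 + d = n) (hC : IsLinearCode (e + 3) d C) (φ : Dual F C) :
    IsLengthMaximalCode s (e + 3) (LinearMap.range (snocMap C φ)) ↔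
      ∀ x : C, x ≠ 0 → φ x = 0 → d + 1 ≤ hammingNorm (x : Fin n → F) := by
  obtain ⟨hCd, ⟨x₀, hx₀, hx₀0, hx₀d⟩, hmin⟩ := isLinearCode_iff.1 hC
  have hne : ∀ {x : C}, x ≠ 0 → snocMap C φ x ≠ 0 := fun hx hc =>
    hx (snocMap_injective C φ (hc.trans (map_zero _).symm))
  constructor
  · rintro ⟨d', hlin, hdef, -⟩ x hx hφ
    simp only [singletonDefect] at hdef
    have h1 := (isLinearCode_iff.1 hlin).2.2 _ ⟨x, rfl⟩ (hne hx)
    rw [hammingNorm_snocMap, if_pos hφ] at h1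
    omega
  · intro h
    refine ⟨d + 1, isLinearCode_iff.2 ⟨?_, ⟨_, ⟨⟨x₀, hx₀⟩, rfl⟩, ?_, ?_⟩, ?_⟩, ?_, ?_⟩
    · rw [LinearMap.finrank_range_of_inj (snocMap_injective C φ), hCd]
    · exact hne fun hc => hx₀0 (congrArg Subtype.val hc)
    · rw [hammingNorm_snocMap, if_neg, hx₀d]
      intro hφ
      have := h ⟨x₀, hx₀⟩ (fun hc => hx₀0 (congrArg Subtype.val hc)) hφ
      simp only at this
      omega
    · rintro _ ⟨x, rfl⟩ hx
      have hx0 : x ≠ 0 := by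
        rintro rfl
        exact hx (map_zero _)
      rw [hammingNorm_snocMap]
      split_ifs with hφ
      · exact h x hx0 hφ
      · exact Nat.add_le_add_right (hmin x x.2 (by simpa using hx0)) 1
    · simp only [singletonDefect]
      omega
    · simp only [IsMaximalLength, hn]
      push_cast
      ring

theorem exists_lengthMaximalCode (hdvd : s + 2 ∣ Fintype.card F)
    (hn : n = (s + 1) * (Fintype.card F + 1) + e) (hd : s + e + 2 + d = n)
    (hC : IsLinearCode (e + 3) d C) :
    ∃ C' : Submodule F (Fin (n + 1) → F), IsCodeExtension C C' ∧
      IsLengthMaximalCode s (e + 3) C' := by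
  obtain ⟨W, ⟨hW, hWle⟩, -⟩ := (nearMaximal_coords hdvd hn hd hC).existsUnique_extension_point
  obtain ⟨φ, rfl⟩ := exists_eq_span_singleton hW
  exact ⟨_, isCodeExtension_range_snocMap C φ,
    (isLengthMaximalCode_range_snocMap_iff hn hd hC φ).2 ((forall_cnt_le_iff hd hC φ).1 hWle)⟩

theorem sameUpToLastScaling (hdvd : s + 2 ∣ Fintype.card F)
    (hn : n = (s + 1) * (Fintype.card F + 1) + e) (hd : s + e + 2 + d = n)
    (hC : IsLinearCode (e + 3) d C) {C₁ C₂ : Submodule F (Fin (n + 1) → F)}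
    (h₁ : IsCodeExtension C C₁) (hm₁ : IsLengthMaximalCode s (e + 3) C₁)
    (h₂ : IsCodeExtension C C₂) (hm₂ : IsLengthMaximalCode s (e + 3) C₂) :
    SameUpToLastScaling C₁ C₂ := by
  obtain ⟨φ₁, rfl⟩ := eq_range_snocMap h₁ (by rw [hC.1]; exact hm₁.choose_spec.1.1)
  obtain ⟨φ₂, rfl⟩ := eq_range_snocMap h₂ (by rw [hC.1]; exact hm₂.choose_spec.1.1)
  obtain ⟨-, ⟨x₀, hx₀, hx₀0, hx₀d⟩, -⟩ := isLinearCode_iff.1 hC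
  have key : ∀ φ : Dual F C, IsLengthMaximalCode s (e + 3) (LinearMap.range (snocMap C φ)) →
      finrank F (F ∙ φ) = 1 ∧
        ∀ H, F ∙ φ ≤ H → finrank F H = e + 2 → cnt (coords C) H ≤ s + 1 + e := by
    intro φ hφ
    rw [isLengthMaximalCode_range_snocMap_iff hn hd hC] at hφ
    refine ⟨finrank_span_singleton ?_, (forall_cnt_le_iff hd hC φ).2 hφ⟩
    -- The zero functional vanishes on the word `x₀` of weight `d`.
    rintro rfl
    have := hφ ⟨x₀, hx₀⟩ (fun hc => hx₀0 (congrArg Subtype.val hc)) rfl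
    simp only at this
    omega
  have hspan := (nearMaximal_coords hdvd hn hd hC).existsUnique_extension_point.unique
    (key φ₁ hm₁) (key φ₂ hm₂)
  obtain ⟨c, rfl⟩ := span_singleton_eq_span_singleton.1 hspan
  refine ⟨c, c.ne_zero, fun z => ⟨?_, ?_⟩⟩
  · rintro ⟨x, rfl⟩
    refine ⟨x, ?_⟩
    ext j
    refine Fin.lastCases ?_ (fun j => ?_) j
    · simp [Units.smul_def]
    · simp [(Fin.castSucc_lt_last j).ne]
  · rintro ⟨x, hx⟩
    refine ⟨x, ?_⟩
    ext j
    have hj := congrFun hx j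
    revert hj
    refine Fin.lastCases ?_ (fun j => ?_) j
    · simp [Units.smul_def]
    · simp [(Fin.castSucc_lt_last j).ne]

end Codes

end PointFamily

theorem mainTheorem2 {F : Type*} [Field F] [Fintype F] [DecidableEq F] (n k d s : ℕ)
    (hk : 3 ≤ k) (hs : 0 < s) (hsq : (s : ℤ) < (Fintype.card F : ℤ) - 2)
    (hdvd : (s + 2) ∣ Fintype.card F)
    (hn : (n : ℤ) = ((s : ℤ) + 1) * ((Fintype.card F : ℤ) + 1) + k - 3)
    (hdefect : singletonDefect n k d = s) :
    (∀ G : Multiset (PG k F), IsProjectiveSystem n d G →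
      ∃! G' : Multiset (PG k F), G ≤ G' ∧ IsLengthMaximalSystem s G') ∧
    (∀ C : Submodule F (Fin n → F), IsLinearCode k d C →
      (∃ C' : Submodule F (Fin (n + 1) → F), IsCodeExtension C C' ∧ IsLengthMaximalCode s k C') ∧
      (∀ C₁ C₂ : Submodule F (Fin (n + 1) → F),
        IsCodeExtension C C₁ → IsLengthMaximalCode s k C₁ →
        IsCodeExtension C C₂ → IsLengthMaximalCode s k C₂ → SameUpToLastScaling C₁ C₂)) := by
  obtain ⟨e, rfl⟩ : ∃ e, k = e + 3 := ⟨k - 3, by omega⟩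
  have hn' : n = (s + 1) * (Fintype.card F + 1) + e := by
    zify
    rw [hn]
    push_cast
    ring
  have hd : s + e + 2 + d = n := by
    simp only [singletonDefect] at hdefect
    omega
  exact ⟨fun G hG => PointFamily.existsUnique_lengthMaximalSystem hdvd hn' hd hG, fun C hC =>
    ⟨PointFamily.exists_lengthMaximalCode hdvd hn' hd hC, fun C₁ C₂ h₁ hm₁ h₂ hm₂ =>
      PointFamily.sameUpToLastScaling hdvd hn' hd hC h₁ hm₁ h₂ hm₂⟩⟩
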